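/- **Conventions.** A *Banach analytic manifold* is a connected topological space with an atlas of charts onto open subsets of a complex Banach space whose transition maps are holomorphic; an open subset of one (not necessarily connected) carries the induced charts. For such spaces $A$ and $X$, $\mathrm{Hol}(A,X)$ is the set of holomorphic maps $A\to X$ with the compact-open topology; a sequence in it is called convergent if it has a limit in $\mathrm{Hol}(A,X)$. For $S\subset A$ let $S^u$ be the set of all $z\in\overline S$ such that for every connected open neighborhood $U$ of $z$, every holomorphic $g:U\to\mathbb C$ with $g|_{U\cap S}=0$ vanishes identically on $U$. For a sequence $\{f_k\}\subset\mathrm{Hol}(A,X)$ let $Z_{\{f_k\}}$ be the set of all $\lambda\in A$ such that $\{f_k(\lambda)\}$ converges in $X$. Then - $X$ has the *strong Vitali property* (SVP) if for every Banach analytic manifold $A$, every sequence $\{f_k\}\subset\mathrm{Hol}(A,X)$ with $Z^u_{\{f_k\}}\neq\emptyset$ converges in $\mathrm{Hol}(A,X)$; - $X$ has the *weak Vitali property* (WVP) if for every Banach analytic manifold $A$, every sequence $\{f_k\}\subset\mathrm{Hol}(A,X)$ with $Z_{\{f_k\}}\cap Z^u_{\{f_k\}}\neq\emptyset$ converges in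 $\mathrm{Hol}(A,X)$. Let $\Delta\subset\mathbb C$ be the open unit disk, with Poincaré distance $\rho_\Delta(a,b)=\operatorname{artanh}\left|\frac{a-b}{1-\bar a b}\right|$. The Kobayashi pseudo-distance $\kappa_Y(p,q)$ of a Banach analytic manifold $Y$ is the infimum of $\sum_{i=1}^k\rho_\Delta(a_i,b_i)$ over all $k\ge1$, points $p=p_0,p_1,\dots,p_k=q$ of $Y$, points $a_1,b_1,\dots,a_k,b_k\in\Delta$ and $f_1,\dots,f_k\in\mathrm{Hol}(\Delta,Y)$ with $f_i(a_i)=p_{i-1}$ and $f_i(b_i)=p_i$ for $1\le i\le k$. The manifold $Y$ is *hyperbolic* if $\kappa_Y$ is a distance that defines the topology of $Y$, and *complete hyperbolic* if, moreover, every $\kappa_Y$-Cauchy sequence converges in $Y$. **Corollary 3.13.** Let $X$ be an open subset of a complete hyperbolic Banach analytic manifold $Y$. Then $X$ has WVP if and only if $X$ has SVP. In particular, if $X$ is a bounded open subset of a complex Banach space, then $X$ has WVP if and only if $X$ has SVP. -/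

import Mathlib

open Filter Set TopologicalSpace
open scoped Manifold ContDiff Topology ENNReal ComplexConjugate

universe u v w t

noncomputable section

namespace Vitali

section Hol

/-- `Hol F A E X` is the set of holomorphic maps from `A` (modelled on `F`) to `X` (modelled
on `E`). Holomorphic means complex (Fréchet) differentiable in charts. -/
def Hol (F : Type w) [NormedAddCommGroup F] [NormedSpace ℂ F]
    (A : Type t) [TopologicalSpace A] [ChartedSpace F A]
    (E : Type u) [NormedAddCommGroup E] [NormedSpace ℂ E]
    (X : Type v) [TopologicalSpace X] [ChartedSpace E X] : Type (max t v) :=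
  {f : C(A, X) // MDifferentiable 𝓘(ℂ, F) 𝓘(ℂ, E) f}

/-- `Hol F A E X` carries the compact-open topology (`C(A, X)` has it in Mathlib). -/
instance Hol.instTopologicalSpace (F : Type w) [NormedAddCommGroup F] [NormedSpace ℂ F]
    (A : Type t) [TopologicalSpace A] [ChartedSpace F A]
    (E : Type u) [NormedAddCommGroup E] [NormedSpace ℂ E]
    (X : Type v) [TopologicalSpace X] [ChartedSpace E X] :
    TopologicalSpace (Hol F A E X) :=
  inferInstanceAs (TopologicalSpace {f : C(A, X) // MDifferentiable 𝓘(ℂ, F) 𝓘(ℂ, E) f})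

end Hol

section VitaliProperties

/-- The set `Z_{f_k}` of the points at which the sequence of maps `f` converges (in `X`). -/
def convergenceSet {A : Type t} {X : Type v} [TopologicalSpace X] (f : ℕ → A → X) : Set A :=
  {z | ∃ x : X, Tendsto (fun k => f k z) atTop (𝓝 x)}

/-- The set `S^u` of the points `z` of the closure of `S` such that, on every connected open
neighborhood `U` of `z`, a holomorphic function on `U` that vanishes on `U ∩ S` vanishes
identically. -/
def uniquenessPoints (F : Type w) [NormedAddCommGroup F] [NormedSpace ℂ F]
    {A : Type t} [TopologicalSpace A] [ChartedSpace F A] (S : Set A) : Set A :=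
  {z | z ∈ closure S ∧ ∀ U : Set A, IsOpen U → IsConnected U → z ∈ U →
    ∀ g : A → ℂ, MDifferentiableOn 𝓘(ℂ, F) 𝓘(ℂ, ℂ) g U →
      (∀ y ∈ U ∩ S, g y = 0) → ∀ y ∈ U, g y = 0}

/-- The strong Vitali property: for every Banach analytic manifold `A` (connected, modelled on some
complex Banach space `F`), every sequence in `Hol(A, X)` with `Z^u ≠ ∅` converges in `Hol(A, X)`. -/
def SVP (E : Type u) [NormedAddCommGroup E] [NormedSpace ℂ E]
    (X : Type v) [TopologicalSpace X] [ChartedSpace E X] : Prop :=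
  ∀ (F : Type w) [NormedAddCommGroup F] [NormedSpace ℂ F] [CompleteSpace F]
    (A : Type t) [TopologicalSpace A] [ChartedSpace F A] [IsManifold 𝓘(ℂ, F) ω A]
    [ConnectedSpace A] (f : ℕ → Hol F A E X),
    (uniquenessPoints F (convergenceSet fun k => ⇑(f k).1)).Nonempty →
      ∃ g : Hol F A E X, Tendsto f atTop (𝓝 g)

/-- The weak Vitali property: for every Banach analytic manifold `A` (connected, modelled on some
complex Banach space `F`), every sequence in `Hol(A, X)` with `Z ∩ Z^u ≠ ∅` converges in
`Hol(A, X)`. -/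
def WVP (E : Type u) [NormedAddCommGroup E] [NormedSpace ℂ E]
    (X : Type v) [TopologicalSpace X] [ChartedSpace E X] : Prop :=
  ∀ (F : Type w) [NormedAddCommGroup F] [NormedSpace ℂ F] [CompleteSpace F]
    (A : Type t) [TopologicalSpace A] [ChartedSpace F A] [IsManifold 𝓘(ℂ, F) ω A]
    [ConnectedSpace A] (f : ℕ → Hol F A E X),
    ((convergenceSet fun k => ⇑(f k).1) ∩
      uniquenessPoints F (convergenceSet fun k => ⇑(f k).1)).Nonempty →
      ∃ g : Hol F A E X, Tendsto f atTop (𝓝 g)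

end VitaliProperties

section Hyperbolicity

/-- The Poincaré distance on the unit disk. -/
def poincareDist (a b : ℂ) : ℝ := Real.artanh ‖(a - b) / (1 - conj a * b)‖

/-- A holomorphic chain from `p` to `q`: points `p = p₀, …, p_k = q` and, for `i < k`, a holomorphic
map `f_i` from the open unit disk to `X` and points `a_i`, `b_i` of the disk with
`f_i (a_i) = p_i` and `f_i (b_i) = p_{i+1}`. The values of the sequences `a`, `b`, `f` at
indices `≥ k`, those of `point` at indices `> k`, and the values of the `f_i` outside the disk,
are irrelevant. -/
structure HolomorphicChain (E : Type u) [NormedAddCommGroup E] [NormedSpace ℂ E]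
    {X : Type v} [TopologicalSpace X] [ChartedSpace E X] (p q : X) where
  k : ℕ
  point : ℕ → X
  a : ℕ → ℂ
  b : ℕ → ℂ
  f : ℕ → ℂ → X
  one_le : 1 ≤ k
  point_zero : point 0 = p
  point_last : point k = q
  a_mem : ∀ i < k, a i ∈ Metric.ball (0 : ℂ) 1
  b_mem : ∀ i < k, b i ∈ Metric.ball (0 : ℂ) 1
  holo : ∀ i < k, MDifferentiableOn 𝓘(ℂ, ℂ) 𝓘(ℂ, E) (f i) (Metric.ball (0 : ℂ) 1)
  map_a : ∀ i < k, f i (a i) = point i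
  map_b : ∀ i < k, f i (b i) = point (i + 1)

/-- The length of a holomorphic chain. -/
def HolomorphicChain.length {E : Type u} [NormedAddCommGroup E] [NormedSpace ℂ E]
    {X : Type v} [TopologicalSpace X] [ChartedSpace E X] {p q : X}
    (c : HolomorphicChain E p q) : ℝ :=
  ∑ i ∈ Finset.range c.k, poincareDist (c.a i) (c.b i)

/-- The Kobayashi pseudo-distance: the infimum of the lengths of the holomorphic chains joining two
points, as an extended nonnegative real (`∞` when there is no chain, which does not happen on a
connected manifold). -/
def kobayashi (E : Type u) [NormedAddCommGroup E] [NormedSpace ℂ E]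
    {X : Type v} [TopologicalSpace X] [ChartedSpace E X] (p q : X) : ℝ≥0∞ :=
  ⨅ c : HolomorphicChain E p q, ENNReal.ofReal c.length

/-- `X` is hyperbolic: the Kobayashi pseudo-distance is a distance, and it defines the topology. -/
structure IsHyperbolic (E : Type u) [NormedAddCommGroup E] [NormedSpace ℂ E]
    (X : Type v) [TopologicalSpace X] [ChartedSpace E X] : Prop where
  eq_of_kobayashi_eq_zero : ∀ p q : X, kobayashi E p q = 0 → p = q
  isOpen_iff : ∀ U : Set X, IsOpen U ↔
    ∀ p ∈ U, ∃ ε : ℝ≥0∞, 0 < ε ∧ ∀ q : X, kobayashi E p q < ε → q ∈ U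

/-- `X` is complete hyperbolic: it is hyperbolic, and every sequence that is Cauchy for the Kobayashi
distance converges in `X`. -/
structure IsCompleteHyperbolic (E : Type u) [NormedAddCommGroup E] [NormedSpace ℂ E]
    (X : Type v) [TopologicalSpace X] [ChartedSpace E X] : Prop extends IsHyperbolic E X where
  complete : ∀ x : ℕ → X,
    (∀ ε : ℝ≥0∞, 0 < ε → ∃ N, ∀ m ≥ N, ∀ n ≥ N, kobayashi E (x m) (x n) < ε) →
      ∃ y : X, Tendsto x atTop (𝓝 y)

end Hyperbolicity

end Vitali

end

namespace Vitali

open Metric BoundedContinuousFunction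

/-! ### Bounded sequences of holomorphic maps on a ball. -/

section Bounded

variable {F E : Type*} [NormedAddCommGroup F] [NormedSpace ℂ F]
  [NormedAddCommGroup E] [NormedSpace ℂ E]

/-! SVP trivially gives WVP. For the converse, let `f k` converge on `Z`, with `z` in `Z^u` but
perhaps not in `Z`. It suffices that the `f k` are equicontinuous into a complete space containing
`X` as an open set: for hyperbolic `Y` holomorphic maps do not increase the Kobayashi distance, and
for bounded `X` the Schwarz lemma applies (`equicontinuous_kobayashi`, `equicontinuous_of_bounded`).

Since `z` is in the closure of `Z`, `f k z` is Cauchy and converges in the complete space. A tail of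
the sequence maps a neighborhood of `z` into one chart ball about the limit, and Vitali's theorem
for bounded maps (`cauchySeq_of_uniqueness`) gives convergence near `z`, with limits possibly
outside `X`. Now move to a nearby `z₁` in `Z`: its limit is in the open set `X`, and by
equicontinuity so are the limits near `z₁`. Thus `Z` is a neighborhood of `z₁`, so `z₁` is in `Z ∩
Z^u` and WVP applies (`WVP.svp`). -/

/-- A holomorphic map bounded by `M` on a ball differs from its linear Taylor polynomial at the
center by at most `4 * M * (dist z c / R) ^ 2`. -/
theorem norm_sub_sub_fderiv_le {f : F → E} {c z : F} {R M : ℝ}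
    (hd : DifferentiableOn ℂ f (ball c R)) (hM : ∀ z ∈ ball c R, ‖f z‖ ≤ M)
    (hz : z ∈ ball c R) :
    ‖f z - f c - fderiv ℂ f c (z - c)‖ ≤ 4 * M * (dist z c / R) ^ 2 := by
  have hR : 0 < R := nonempty_ball.1 ⟨z, hz⟩
  have hc : c ∈ ball c R := mem_ball_self hR
  have hmaps : MapsTo f (ball c R) (closedBall (f c) (2 * M)) := fun y hy => by
    rw [mem_closedBall, dist_eq_norm]
    linarith [norm_sub_le (f y) (f c), hM y hy, hM c hc]
  have hfd : ‖fderiv ℂ f c‖ ≤ 2 * M / R := Complex.norm_fderiv_le_div_of_mapsTo_ball hd hmaps hR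
  have hdc : DifferentiableAt ℂ f c := hd.differentiableAt (ball_mem_nhds c hR)
  -- Higher-order Schwarz lemma: the remainder is `o(‖w - c‖)`, and it is bounded by `4 * M`, half
  -- from `f w - f c` and half from the linear term via the Cauchy estimate.
  have key := Complex.dist_le_mul_div_pow_of_mapsTo_ball_of_isLittleO (n := 1)
    (f := fun w => f w - f c - fderiv ℂ f c (w - c)) (c := c) (z := z) (R₁ := R) (R₂ := 4 * M)
    (by fun_prop) ?_ ?_ hz
  · simpa using key
  · intro y hy
    have h1 := hmaps hy
    rw [mem_closedBall, dist_eq_norm] at h1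
    have h2 : ‖fderiv ℂ f c (y - c)‖ ≤ 2 * M := by
      refine (ContinuousLinearMap.le_of_opNorm_le _ hfd _).trans ?_
      rw [mem_ball, dist_eq_norm] at hy
      have hM0 : 0 ≤ M := (norm_nonneg _).trans (hM c hc)
      calc 2 * M / R * ‖y - c‖ ≤ 2 * M / R * R := by gcongr
        _ = 2 * M := by field_simp
    simp only [mem_closedBall, sub_self, map_zero, dist_zero_right]
    linarith [norm_sub_le (f y - f c) (fderiv ℂ f c (y - c))]
  · simpa using hdc.hasFDerivAt.isLittleO.norm_right

/-- A uniformly bounded sequence of holomorphic maps on a ball, seen as one map with values in the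
space of bounded sequences, is holomorphic. -/
theorem exists_differentiableOn_bounded_sequence {h : ℕ → F → E} {c : F} {R M : ℝ}
    (hd : ∀ k, DifferentiableOn ℂ (h k) (ball c R)) (hM : ∀ k, ∀ z ∈ ball c R, ‖h k z‖ ≤ M) :
    ∃ H : F → (ℕ →ᵇ E), DifferentiableOn ℂ H (ball c R) ∧
      ∀ z ∈ ball c R, ∀ k, H z k = h k z := by
  classical
  let H : F → (ℕ →ᵇ E) := fun z => if hz : z ∈ ball c R then
    ofNormedAddCommGroupDiscrete (fun k => h k z) M (fun k => hM k z hz) else 0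
  have hH : ∀ z ∈ ball c R, ∀ k, H z k = h k z := fun z hz k => by
    have : H z = ofNormedAddCommGroupDiscrete (fun k => h k z) M (fun k => hM k z hz) := dif_pos hz
    rw [this]
    rfl
  refine ⟨H, fun x hx => ?_, hH⟩
  obtain ⟨r, hr, hrs⟩ := Metric.isOpen_iff.1 isOpen_ball x hx
  have hM0 : 0 ≤ M := (norm_nonneg _).trans (hM 0 x hx)
  have hmaps : ∀ k, MapsTo (h k) (ball x r) (closedBall (h k x) (2 * M)) := fun k y hy => by
    rw [mem_closedBall, dist_eq_norm]
    linarith [norm_sub_le (h k y) (h k x), hM k y (hrs hy), hM k x hx]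
  have hfd : ∀ k, ‖fderiv ℂ (h k) x‖ ≤ 2 * M / r := fun k =>
    Complex.norm_fderiv_le_div_of_mapsTo_ball ((hd k).mono hrs) (hmaps k) hr
  have hb : ∀ v k, ‖fderiv ℂ (h k) x v‖ ≤ 2 * M / r * ‖v‖ := fun v k =>
    ContinuousLinearMap.le_of_opNorm_le _ (hfd k) v
  let L : F →L[ℂ] (ℕ →ᵇ E) := LinearMap.mkContinuous
    { toFun := fun v => ofNormedAddCommGroupDiscrete (fun k => fderiv ℂ (h k) x v)
        (2 * M / r * ‖v‖) (hb v)
      map_add' := fun v w => by ext k; simp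
      map_smul' := fun a v => by ext k; simp }
    (2 * M / r) fun v => norm_ofNormedAddCommGroup_le _ (by positivity) (hb v)
  have hL : ∀ v k, L v k = fderiv ℂ (h k) x v := fun v k => rfl
  -- The quadratic remainder bound has the same constant for all `k`, so it survives the supremum
  -- over `k`.
  have hbound : ∀ z ∈ ball x r, ‖H z - H x - L (z - x)‖ ≤ 4 * M / r ^ 2 * ‖‖z - x‖ ^ 2‖ := by
    intro z hz
    rw [BoundedContinuousFunction.norm_le (by positivity)]
    intro k
    have := norm_sub_sub_fderiv_le ((hd k).mono hrs) (fun y hy => hM k y (hrs hy)) hz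
    rw [dist_eq_norm, div_pow, mul_div_assoc'] at this
    simpa [hH z (hrs hz), hH x hx, hL, div_mul_eq_mul_div] using this
  have hO : (fun z => H z - H x - L (z - x)) =O[𝓝 x] fun z => ‖z - x‖ ^ 2 :=
    Asymptotics.IsBigO.of_bound _ (eventually_of_mem (ball_mem_nhds x hr) hbound)
  have ho : (fun z => ‖z - x‖ ^ 2) =o[𝓝 x] fun z => z - x :=
    Asymptotics.isLittleO_norm_pow_id one_lt_two |>.comp_tendsto
      (by simpa using (continuous_id.sub continuous_const).tendsto x (f := fun z : F => z - x))
  exact (HasFDerivAt.of_isLittleO (hO.trans_isLittleO ho)).differentiableAt.differentiableWithinAt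

/-- The closed subspace of Cauchy sequences among the bounded sequences. -/
def cauchySubmodule (E : Type*) [NormedAddCommGroup E] [NormedSpace ℂ E] :
    Submodule ℂ (ℕ →ᵇ E) where
  carrier := {b | CauchySeq b}
  add_mem' ha hb := ha.add hb
  zero_mem' := cauchySeq_const 0
  smul_mem' a _ hb := (uniformContinuous_const_smul a).comp_cauchySeq hb

/-- A uniform limit of Cauchy sequences is Cauchy. Closedness makes the quotient a normed space, in
which functionals separate points. -/
instance isClosed_cauchySubmodule : IsClosed (cauchySubmodule E : Set (ℕ →ᵇ E)) := by
  refine isClosed_of_closure_subset fun b hb => Metric.cauchySeq_iff.2 fun ε hε => ?_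
  obtain ⟨a, ha, hab⟩ := Metric.mem_closure_iff.1 hb (ε / 3) (by positivity)
  obtain ⟨N, hN⟩ := Metric.cauchySeq_iff.1 (show CauchySeq a from ha) (ε / 3) (by positivity)
  refine ⟨N, fun m hm n hn => ?_⟩
  have h1 := (dist_coe_le_dist (f := b) (g := a) m).trans_lt hab
  have h2 := (dist_coe_le_dist (f := b) (g := a) n).trans_lt hab
  rw [dist_comm] at h2
  linarith [dist_triangle4 (b m) (a m) (a n) (b n), hN m hm n hn]

/-- Vitali's theorem in the form of Arendt and Nikolski: a uniformly bounded sequence of holomorphic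
maps on a ball that is Cauchy on a set of uniqueness `S` is Cauchy everywhere. -/
theorem cauchySeq_of_uniqueness {h : ℕ → F → E} {c : F} {R M : ℝ} {S : Set F}
    (hd : ∀ k, DifferentiableOn ℂ (h k) (ball c R)) (hM : ∀ k, ∀ z ∈ ball c R, ‖h k z‖ ≤ M)
    (hS : ∀ g : F → ℂ, DifferentiableOn ℂ g (ball c R) → (∀ y ∈ ball c R ∩ S, g y = 0) →
      ∀ y ∈ ball c R, g y = 0)
    (hC : ∀ y ∈ ball c R ∩ S, CauchySeq fun k => h k y) {z : F} (hz : z ∈ ball c R) :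
    CauchySeq fun k => h k z := by
  obtain ⟨H, hHd, hH⟩ := exists_differentiableOn_bounded_sequence hd hM
  have hmem : ∀ y ∈ ball c R, (H y ∈ cauchySubmodule E ↔ CauchySeq fun k => h k y) := by
    intro y hy
    rw [← funext (hH y hy)]
    rfl
  rw [← hmem z hz, ← Submodule.Quotient.mk_eq_zero]
  -- Modulo Cauchy sequences, `H` vanishes on `S`. Composing with a functional gives a scalar
  -- holomorphic function, to which uniqueness applies.
  refine SeparatingDual.eq_zero_of_forall_dual_eq_zero (R := ℂ) fun φ => ?_
  refine hS (fun y => φ ((cauchySubmodule E).mkQL (H y))) ?_ (fun y hy => ?_) z hz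
  · fun_prop
  · have : (cauchySubmodule E).mkQL (H y) = 0 :=
      (Submodule.Quotient.mk_eq_zero _).2 ((hmem y hy.1).2 (hC y hy))
    rw [this, map_zero]

/-- Identity theorem on a ball of a normed space. -/
theorem eq_zero_on_ball_of_eventuallyEq {g : F → E} [CompleteSpace E] {c w : F} {R : ℝ}
    (hd : DifferentiableOn ℂ g (ball c R)) (hw : w ∈ ball c R) (h0 : g =ᶠ[𝓝 w] 0) {y : F}
    (hy : y ∈ ball c R) : g y = 0 := by
  -- On the complex line through `w` and `y` this is the one-variable identity theorem.
  let l : ℂ → F := fun s => w + s • (y - w)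
  have hl : Continuous l := by fun_prop
  have hconv : Convex ℝ (l ⁻¹' ball c R) := by
    intro s hs s' hs' a b ha hb hab
    have hlin : l (a • s + b • s') = a • l s + b • l s' := by
      obtain rfl : b = 1 - a := by linarith
      simp only [l, ← Complex.coe_smul, smul_eq_mul, Complex.ofReal_sub, Complex.ofReal_one]
      module
    rw [mem_preimage, hlin]
    exact (convex_ball c R) hs hs' ha hb hab
  have han : AnalyticOnNhd ℂ (g ∘ l) (l ⁻¹' ball c R) :=
    DifferentiableOn.analyticOnNhd
      (hd.comp (by fun_prop) (mapsTo_preimage l _)) (isOpen_ball.preimage hl)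
  have hl0 : l 0 = w := by simp [l]
  have hl1 : l 1 = y := by simp [l]
  have := han.eqOn_zero_of_preconnected_of_eventuallyEq_zero hconv.isPreconnected
    (z₀ := 0) (by simpa [hl0] using hw)
    ((hl.tendsto' 0 w hl0).eventually h0)
    (show (1 : ℂ) ∈ l ⁻¹' ball c R by simpa [hl1] using hy)
  simpa [hl1] using this

end Bounded

/-! ### Chart balls and the identity theorem on manifolds. -/

section Charts

variable {F : Type*} [NormedAddCommGroup F] [NormedSpace ℂ F]
  {A : Type*} [TopologicalSpace A] [ChartedSpace F A]

omit [NormedSpace ℂ F] in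
theorem exists_ball_subset_chart (z : A) {s : Set A} (hs : s ∈ 𝓝 z) :
    ∃ r > 0, ball (chartAt F z z) r ⊆ (chartAt F z).target ∩ (chartAt F z).symm ⁻¹' s := by
  refine Metric.mem_nhds_iff.1 (inter_mem (chart_target_mem_nhds F z) ?_)
  exact ((chartAt F z).continuousAt_symm (mem_chart_target F z)).preimage_mem_nhds
    (by rwa [(chartAt F z).left_inv (mem_chart_source F z)])

/-- The part of the chart domain at `z` that corresponds to a ball around the image of `z`. -/
def chartBall (F : Type*) [NormedAddCommGroup F] [NormedSpace ℂ F]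
    {A : Type*} [TopologicalSpace A] [ChartedSpace F A] (z : A) (r : ℝ) : Set A :=
  (chartAt F z).source ∩ chartAt F z ⁻¹' ball (chartAt F z z) r

theorem isOpen_chartBall (z : A) (r : ℝ) : IsOpen (chartBall F z r) :=
  (chartAt F z).isOpen_inter_preimage isOpen_ball

theorem mem_chartBall_self (z : A) {r : ℝ} (hr : 0 < r) : z ∈ chartBall F z r :=
  ⟨mem_chart_source F z, mem_ball_self hr⟩

theorem chartBall_mem_nhds (z : A) {r : ℝ} (hr : 0 < r) : chartBall F z r ∈ 𝓝 z :=
  (isOpen_chartBall z r).mem_nhds (mem_chartBall_self z hr)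

theorem isConnected_chartBall (z : A) {r : ℝ} (hr : 0 < r)
    (hsub : ball (chartAt F z z) r ⊆ (chartAt F z).target) : IsConnected (chartBall F z r) := by
  let : NormedSpace ℝ F := NormedSpace.restrictScalars ℝ ℂ F
  have himage : chartBall F z r = (chartAt F z).symm '' ball (chartAt F z z) r := by
    rw [(chartAt F z).symm_image_eq_source_inter_preimage hsub, chartBall]
  rw [himage]
  exact ((convex_ball _ _).isConnected ⟨_, mem_ball_self hr⟩).image _
    ((chartAt F z).continuousOn_symm.mono hsub)

variable {E : Type*} [NormedAddCommGroup E] [NormedSpace ℂ E]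
  {Y : Type*} [TopologicalSpace Y] [ChartedSpace E Y]

theorem mdifferentiableOn_comp_chart_symm [IsManifold 𝓘(ℂ, F) 1 A] {f : A → Y} {U : Set A}
    (hf : MDifferentiableOn 𝓘(ℂ, F) 𝓘(ℂ, E) f U) (z : A) {s : Set F}
    (hs : s ⊆ (chartAt F z).target ∩ (chartAt F z).symm ⁻¹' U) :
    MDifferentiableOn 𝓘(ℂ, F) 𝓘(ℂ, E) (f ∘ (chartAt F z).symm) s :=
  hf.comp ((mdifferentiableOn_atlas_symm (chart_mem_atlas F z)).mono fun _ hx => (hs hx).1)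
    fun _ hx => (hs hx).2

/-- Identity theorem on a manifold modelled on a complex normed space. -/
theorem eqOn_zero_of_isPreconnected_of_eventuallyEq [IsManifold 𝓘(ℂ, F) 1 A] [CompleteSpace E]
    {U : Set A} (hU : IsOpen U) (hc : IsPreconnected U) {g : A → E}
    (hg : MDifferentiableOn 𝓘(ℂ, F) 𝓘(ℂ, E) g U) {z : A} (hz : z ∈ U)
    (h0 : ∀ᶠ y in 𝓝 z, g y = 0) : ∀ y ∈ U, g y = 0 := by
  have hsub : U ⊆ {x | ∀ᶠ y in 𝓝 x, g y = 0} := by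
    -- The set of points near which `g` vanishes is open; by the identity theorem on a chart ball it
    -- is also closed in `U`.
    refine hc.subset_of_closure_inter_subset isOpen_setOfPred_eventually_nhds ⟨z, hz, h0⟩ ?_
    rintro x ⟨hx, hxU⟩
    obtain ⟨r, hr, hrs⟩ := exists_ball_subset_chart (F := F) x (hU.mem_nhds hxU)
    obtain ⟨w, ⟨hws, hwb⟩, hw⟩ := mem_closure_iff_nhds.1 hx _ (chartBall_mem_nhds (F := F) x hr)
    have hd := (mdifferentiableOn_comp_chart_symm hg x hrs).differentiableOn
    have hw' : ∀ᶠ y in 𝓝 ((chartAt F x).symm (chartAt F x w)), g y = 0 := by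
      rwa [(chartAt F x).left_inv hws]
    have hw0 : g ∘ (chartAt F x).symm =ᶠ[𝓝 (chartAt F x w)] 0 :=
      ((chartAt F x).continuousAt_symm ((chartAt F x).map_source hws)).tendsto.eventually hw'
    filter_upwards [chartBall_mem_nhds (F := F) x hr] with y hy
    have := eq_zero_on_ball_of_eventuallyEq hd hwb hw0 hy.2
    rwa [Function.comp_apply, (chartAt F x).left_inv hy.1] at this
  exact fun y hy => (hsub hy).self_of_nhds

/-- Every point near which `S` is everything is a point of uniqueness for `S`. -/
theorem mem_uniquenessPoints_of_mem_nhds [IsManifold 𝓘(ℂ, F) 1 A] {S : Set A} {z : A}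
    (hS : S ∈ 𝓝 z) : z ∈ uniquenessPoints F S := by
  refine ⟨subset_closure (mem_of_mem_nhds hS), fun U hU hc hz g hg h0 => ?_⟩
  refine eqOn_zero_of_isPreconnected_of_eventuallyEq hU hc.isPreconnected hg hz ?_
  filter_upwards [hS, hU.mem_nhds hz] with y hy hyU using h0 y ⟨hyU, hy⟩

end Charts

/-! ### Equicontinuous sequences and the local Vitali theorem. -/

section Equicontinuous

/-- Compare `f m z` and `f n z` through `f m x` and `f n x`, for `x` in `S` close to `z`. -/
theorem cauchySeq_of_equicontinuousAt_of_mem_closure {A Y : Type*} [TopologicalSpace A]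
    [UniformSpace Y] {f : ℕ → A → Y} {z : A} {S : Set A} (hf : EquicontinuousAt f z)
    (hz : z ∈ closure S) (hS : ∀ x ∈ S, CauchySeq fun k => f k x) : CauchySeq fun k => f k z := by
  rw [_root_.cauchySeq_iff]
  intro V hV
  obtain ⟨V', hV', hsymm, hcomp⟩ := comp_comp_symm_mem_uniformity_sets hV
  obtain ⟨x, hx, hxS⟩ := mem_closure_iff_nhds.1 hz _ (hf V' hV')
  obtain ⟨N, hN⟩ := _root_.cauchySeq_iff.1 (hS x hxS) V' hV'
  exact ⟨N, fun m hm n hn => hcomp ⟨f n x, ⟨f m x, hx m, hN m hm n hn⟩, hsymm.symm _ _ (hx n)⟩⟩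

theorem exists_forall_mem_of_equicontinuousAt {A Y : Type*} [TopologicalSpace A]
    [UniformSpace Y] {f : ℕ → A → Y} {z : A} {y : Y} (hf : EquicontinuousAt f z)
    (hy : Tendsto (fun k => f k z) atTop (𝓝 y)) {W : Set Y} (hW : W ∈ 𝓝 y) :
    ∃ N, ∃ U ∈ 𝓝 z, ∀ k ≥ N, ∀ x ∈ U, f k x ∈ W := by
  obtain ⟨V, hV, hVW⟩ := UniformSpace.mem_nhds_iff.1 hW
  obtain ⟨V', hV', hcomp⟩ := comp_mem_uniformity_sets hV
  obtain ⟨N, hN⟩ := eventually_atTop.1 (hy.eventually (UniformSpace.ball_mem_nhds y hV'))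
  exact ⟨N, _, hf V' hV', fun k hk x hx => hVW (hcomp ⟨f k z, hN k hk, hx k⟩)⟩

/-- Shrinking `W` to a closed neighborhood keeps the limits inside. This is what keeps limits in the
open set `X`. -/
theorem eventually_limit_mem_of_equicontinuousAt {A Y : Type*} [TopologicalSpace A]
    [UniformSpace Y] {f : ℕ → A → Y} {z : A} {y : Y} (hf : EquicontinuousAt f z)
    (hy : Tendsto (fun k => f k z) atTop (𝓝 y)) {W : Set Y} (hW : W ∈ 𝓝 y) :
    ∀ᶠ x in 𝓝 z, ∀ y', Tendsto (fun k => f k x) atTop (𝓝 y') → y' ∈ W := by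
  obtain ⟨W', hW', hclosed, hsub⟩ := exists_mem_nhds_isClosed_subset hW
  obtain ⟨N, U, hU, hN⟩ := exists_forall_mem_of_equicontinuousAt hf hy hW'
  filter_upwards [hU] with x hx y' hy'
  exact hsub (hclosed.mem_of_tendsto hy' (eventually_atTop.2 ⟨N, fun k hk => hN k hk x hx⟩))

variable {F : Type*} [NormedAddCommGroup F] [NormedSpace ℂ F]
  {A : Type*} [TopologicalSpace A] [ChartedSpace F A] [IsManifold 𝓘(ℂ, F) 1 A]
  {E : Type*} [NormedAddCommGroup E] [NormedSpace ℂ E] [CompleteSpace E]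
  {Y : Type*} [UniformSpace Y] [CompleteSpace Y] [ChartedSpace E Y] [IsManifold 𝓘(ℂ, E) 1 Y]

/-- Local Vitali theorem: an equicontinuous sequence of holomorphic maps to a complete space that
converges on a set `S` converges near each point of uniqueness of `S`. -/
theorem eventually_exists_tendsto_of_mem_uniquenessPoints {f : ℕ → A → Y}
    (hhol : ∀ k, MDifferentiable 𝓘(ℂ, F) 𝓘(ℂ, E) (f k)) {S : Set A} {z : A}
    (hf : EquicontinuousAt f z) (hz : z ∈ uniquenessPoints F S)
    (hS : ∀ x ∈ S, ∃ y, Tendsto (fun k => f k x) atTop (𝓝 y)) :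
    ∀ᶠ x in 𝓝 z, ∃ y, Tendsto (fun k => f k x) atTop (𝓝 y) := by
  obtain ⟨y₀, hy₀⟩ := cauchySeq_tendsto_of_complete <|
    cauchySeq_of_equicontinuousAt_of_mem_closure hf hz.1 fun x hx => (hS x hx).choose_spec.cauchySeq
  obtain ⟨r', hr', hrs'⟩ := exists_ball_subset_chart (F := E) y₀ univ_mem
  set χ := chartAt E y₀
  -- Strictly smaller than `r'`, so that limits of points of the ball still lie in the chart target.
  obtain ⟨r, hr, hrr'⟩ := exists_between hr'
  have htarget : closedBall (χ y₀) r ⊆ χ.target := fun e he =>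
    (hrs' (closedBall_subset_ball hrr' he)).1
  -- Closed, so that limits at points of `S` stay in the chart domain, where `χ` is continuous.
  obtain ⟨W, hW, hWc, hWsub⟩ := exists_mem_nhds_isClosed_subset (chartBall_mem_nhds (F := E) y₀ hr)
  obtain ⟨N, U₀, hU₀, hN⟩ := exists_forall_mem_of_equicontinuousAt hf hy₀ hW
  obtain ⟨R, hR, hRs⟩ := exists_ball_subset_chart (F := F) z hU₀
  set φ := chartAt F z
  let h : ℕ → F → E := fun k => χ ∘ f (k + N) ∘ φ.symm
  have hfW : ∀ k, ∀ e ∈ ball (φ z) R, f (k + N) (φ.symm e) ∈ W := fun k e he =>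
    hN _ (Nat.le_add_left N k) _ (hRs he).2
  have hd : ∀ k, DifferentiableOn ℂ (h k) (ball (φ z) R) := fun k => by
    have h1 := mdifferentiableOn_comp_chart_symm (hhol (k + N)).mdifferentiableOn z
      (s := ball (φ z) R) (U := univ) fun e he => ⟨(hRs he).1, mem_univ _⟩
    exact ((mdifferentiableOn_atlas (chart_mem_atlas E y₀)).comp h1
      fun e he => (hWsub (hfW k e he)).1).differentiableOn
  have hdist : ∀ k, ∀ e ∈ ball (φ z) R, dist (h k e) (χ y₀) ≤ r := fun k e he =>
    (hWsub (hfW k e he)).2.le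
  have hbound : ∀ k, ∀ e ∈ ball (φ z) R, ‖h k e‖ ≤ ‖χ y₀‖ + r := fun k e he => by
    have h1 := hdist k e he
    rw [dist_eq_norm] at h1
    linarith [norm_le_norm_add_norm_sub' (h k e) (χ y₀)]
  have hunique : ∀ g : F → ℂ, DifferentiableOn ℂ g (ball (φ z) R) →
      (∀ e ∈ ball (φ z) R ∩ φ.symm ⁻¹' S, g e = 0) → ∀ e ∈ ball (φ z) R, g e = 0 := by
    intro g hg h0 e he
    -- A function on the ball is pulled back to a connected neighborhood of `z` in `A`, where the
    -- uniqueness property of `z` is available.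
    have h1 := hz.2 (chartBall F z R) (isOpen_chartBall z R)
      (isConnected_chartBall z hR fun e he => (hRs he).1) (mem_chartBall_self z hR) (g ∘ φ)
      (hg.mdifferentiableOn.comp ((mdifferentiableOn_atlas (chart_mem_atlas F z)).mono
        inter_subset_left) fun x hx => hx.2)
      (fun x hx => h0 _ ⟨hx.1.2, by rw [mem_preimage, φ.left_inv hx.1.1]; exact hx.2⟩)
      (φ.symm e) ⟨φ.map_target (hRs he).1, by
        rwa [mem_preimage, φ.right_inv (hRs he).1]⟩
    rwa [Function.comp_apply, φ.right_inv (hRs he).1] at h1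
  have hcauchy : ∀ e ∈ ball (φ z) R ∩ φ.symm ⁻¹' S, CauchySeq fun k => h k e := by
    rintro e ⟨he, heS⟩
    obtain ⟨y, hy⟩ := hS _ heS
    replace hy := (tendsto_add_atTop_iff_nat N).2 hy
    have hyW : y ∈ W := hWc.mem_of_tendsto hy (Eventually.of_forall fun k => hfW k e he)
    exact ((χ.continuousAt (hWsub hyW).1).tendsto.comp hy).cauchySeq
  filter_upwards [chartBall_mem_nhds (F := F) z hR] with x hx
  obtain ⟨e, he⟩ := cauchySeq_tendsto_of_complete <|
    cauchySeq_of_uniqueness hd hbound hunique hcauchy hx.2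
  have het : e ∈ χ.target := htarget <|
    isClosed_closedBall.mem_of_tendsto he (Eventually.of_forall fun k => hdist k _ hx.2)
  refine ⟨χ.symm e, (tendsto_add_atTop_iff_nat N).1 ?_⟩
  refine ((χ.continuousAt_symm het).tendsto.comp he).congr fun k => ?_
  have h1 := (hWsub (hfW k _ hx.2)).1
  simp only [Function.comp_apply, h]
  rw [χ.left_inv h1, φ.left_inv hx.1]

end Equicontinuous

/-! ### From the weak to the strong property. -/

section Main

/-- For an open subset of a complete space in which all sequences of holomorphic maps are
equicontinuous, the weak Vitali property implies the strong one. -/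
theorem WVP.svp {E : Type u} [NormedAddCommGroup E] [NormedSpace ℂ E] [CompleteSpace E]
    {Y : Type v} [TopologicalSpace Y] [ChartedSpace E Y] [IsManifold 𝓘(ℂ, E) ω Y]
    (X : Opens Y) (𝒰 : UniformSpace Y) (htop : 𝒰.toTopologicalSpace = ‹TopologicalSpace Y›)
    (hcomplete : CompleteSpace Y)
    (hequi : ∀ (F : Type w) [NormedAddCommGroup F] [NormedSpace ℂ F]
      (A : Type t) [TopologicalSpace A] [ChartedSpace F A] [IsManifold 𝓘(ℂ, F) ω A]
      (f : ℕ → A → Y), (∀ k, MDifferentiable 𝓘(ℂ, F) 𝓘(ℂ, E) (f k)) → (∀ k x, f k x ∈ X) →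
        Equicontinuous f)
    (h : WVP.{u, v, w, t} E X) : SVP.{u, v, w, t} E X := by
  subst htop
  intro F _ _ _ A _ _ _ _ f ⟨z, hz⟩
  have : IsManifold 𝓘(ℂ, F) 1 A := IsManifold.of_le (n := ω) le_top
  have : IsManifold 𝓘(ℂ, E) 1 Y := IsManifold.of_le (n := ω) le_top
  let φ : ℕ → A → Y := fun k x => (f k).1 x
  have hφ : ∀ k, MDifferentiable 𝓘(ℂ, F) 𝓘(ℂ, E) (φ k) := fun k =>
    ((contMDiff_subtype_val (n := 1)).mdifferentiable one_ne_zero).comp (f k).2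
  have hφe : Equicontinuous φ := hequi F A φ hφ fun k x => ((f k).1 x).2
  have hφS : ∀ x ∈ convergenceSet (fun k => ⇑(f k).1),
      ∃ y : X, Tendsto (fun k => φ k x) atTop (𝓝 (y : Y)) := fun x ⟨y, hy⟩ =>
    ⟨y, (continuous_subtype_val.tendsto y).comp hy⟩
  have hev := eventually_exists_tendsto_of_mem_uniquenessPoints hφ (hφe z) hz
    fun x hx => let ⟨y, hy⟩ := hφS x hx; ⟨y, hy⟩
  -- Convergence holds on a whole neighborhood of `z₁`, and at `z₁` itself the limit is in `X`.
  obtain ⟨z₁, hz₁, hz₁S⟩ := mem_closure_iff_nhds.1 hz.1 _ (eventually_eventually_nhds.2 hev)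
  obtain ⟨y₁, hy₁⟩ := hφS z₁ hz₁S
  refine h F A f ⟨z₁, hz₁S, mem_uniquenessPoints_of_mem_nhds ?_⟩
  filter_upwards [hz₁, eventually_limit_mem_of_equicontinuousAt (hφe z₁) hy₁
    (X.isOpen.mem_nhds y₁.2)] with x ⟨y, hy⟩ hxX
  exact ⟨⟨y, hxX y hy⟩, tendsto_subtype_rng.2 hy⟩

theorem SVP.wvp {E : Type u} [NormedAddCommGroup E] [NormedSpace ℂ E]
    {X : Type v} [TopologicalSpace X] [ChartedSpace E X] (h : SVP.{u, v, w, t} E X) :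
    WVP.{u, v, w, t} E X :=
  fun F _ _ _ A _ _ _ _ f hf => h F A f (hf.mono inter_subset_right)

/-- A uniformly bounded sequence of holomorphic maps to a normed space is equicontinuous. -/
theorem equicontinuous_of_bounded {F : Type*} [NormedAddCommGroup F] [NormedSpace ℂ F]
    {A : Type*} [TopologicalSpace A] [ChartedSpace F A] [IsManifold 𝓘(ℂ, F) 1 A]
    {E : Type*} [NormedAddCommGroup E] [NormedSpace ℂ E] {ι : Type*} {f : ι → A → E}
    (hf : ∀ k, MDifferentiable 𝓘(ℂ, F) 𝓘(ℂ, E) (f k)) {M : ℝ} (hM : ∀ k x, ‖f k x‖ ≤ M) :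
    Equicontinuous f := by
  intro z
  obtain ⟨r, hr, hrs⟩ := exists_ball_subset_chart (F := F) z univ_mem
  set φ := chartAt F z
  -- Modulus of continuity from the Schwarz lemma: on a chart ball of radius `r` all values are
  -- within `2 * M` of the value at the center.
  have hcont : Tendsto (fun x => 2 * M / r * dist (φ x) (φ z)) (𝓝 z) (𝓝 0) := by
    have h1 : ContinuousAt φ z := φ.continuousAt (mem_chart_source F z)
    have h2 : ContinuousAt (fun x => 2 * M / r * dist (φ x) (φ z)) z := by fun_prop
    simpa [ContinuousAt] using h2
  refine Metric.equicontinuousAt_of_continuity_modulus _ hcont f ?_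
  filter_upwards [chartBall_mem_nhds (F := F) z hr] with x hx k
  have := Complex.dist_le_div_mul_dist_of_mapsTo_ball (R₂ := 2 * M)
    (mdifferentiableOn_comp_chart_symm (hf k).mdifferentiableOn z hrs).differentiableOn
    (fun e _ => ?_) hx.2
  · change dist (f k (φ.symm (φ x))) (f k (φ.symm (φ z))) ≤ _ at this
    rwa [φ.left_inv hx.1, φ.left_inv (mem_chart_source F z), dist_comm] at this
  · rw [mem_closedBall, dist_eq_norm]
    refine (norm_sub_le _ _).trans ?_
    simp only [Function.comp_apply]
    linarith [hM k (φ.symm e), hM k (φ.symm (φ z))]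

end Main

/-! ### The Kobayashi pseudo-distance and equicontinuity. -/

section Kobayashi

theorem poincareDist_comm (a b : ℂ) : poincareDist a b = poincareDist b a := by
  have h : ‖1 - conj a * b‖ = ‖1 - conj b * a‖ := by
    rw [← Complex.norm_conj]
    simp [mul_comm]
  rw [poincareDist, poincareDist, norm_div, norm_div, norm_sub_rev, h]

variable {E : Type*} [NormedAddCommGroup E] [NormedSpace ℂ E]
  {Y : Type*} [TopologicalSpace Y] [ChartedSpace E Y]

/-- The chain that consists of a single disk. -/
@[simps]
def HolomorphicChain.single {p q : Y} (f : ℂ → Y) (a b : ℂ) (ha : a ∈ ball (0 : ℂ) 1)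
    (hb : b ∈ ball (0 : ℂ) 1) (hf : MDifferentiableOn 𝓘(ℂ, ℂ) 𝓘(ℂ, E) f (ball (0 : ℂ) 1))
    (hp : f a = p) (hq : f b = q) : HolomorphicChain E p q where
  k := 1
  point i := if i = 0 then p else q
  a _ := a
  b _ := b
  f _ := f
  one_le := le_rfl
  point_zero := rfl
  point_last := rfl
  a_mem _ _ := ha
  b_mem _ _ := hb
  holo _ _ := hf
  map_a i hi := by simp [Nat.lt_one_iff.1 hi, hp]
  map_b i _ := by simp [hq]

/-- The chain run through backwards. -/
@[simps]
def HolomorphicChain.reverse {p q : Y} (c : HolomorphicChain E p q) : HolomorphicChain E q p where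
  k := c.k
  point i := c.point (c.k - i)
  a i := c.b (c.k - 1 - i)
  b i := c.a (c.k - 1 - i)
  f i := c.f (c.k - 1 - i)
  one_le := c.one_le
  point_zero := c.point_last
  point_last := by rw [Nat.sub_self, c.point_zero]
  a_mem i hi := c.b_mem _ (by omega)
  b_mem i hi := c.a_mem _ (by omega)
  holo i hi := c.holo _ (by omega)
  map_a i hi := by
    rw [c.map_b _ (by omega)]
    congr 1
    omega
  map_b i hi := by
    rw [c.map_a _ (by omega)]
    congr 1
    omega

theorem HolomorphicChain.length_reverse {p q : Y} (c : HolomorphicChain E p q) :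
    c.reverse.length = c.length := by
  simp only [HolomorphicChain.length, reverse_k, reverse_a, reverse_b]
  rw [← Finset.sum_range_reflect]
  refine Finset.sum_congr rfl fun i hi => ?_
  have hi' := Finset.mem_range.1 hi
  rw [poincareDist_comm, show c.k - 1 - (c.k - 1 - i) = i by omega]

/-- The concatenation of two chains. -/
@[simps]
def HolomorphicChain.append {p q r : Y} (c : HolomorphicChain E p q) (d : HolomorphicChain E q r) :
    HolomorphicChain E p r where
  k := c.k + d.k
  point i := if i < c.k then c.point i else d.point (i - c.k)
  a i := if i < c.k then c.a i else d.a (i - c.k)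
  b i := if i < c.k then c.b i else d.b (i - c.k)
  f i := if i < c.k then c.f i else d.f (i - c.k)
  one_le := c.one_le.trans (Nat.le_add_right _ _)
  point_zero := by rw [if_pos (Nat.lt_of_lt_of_le Nat.zero_lt_one c.one_le), c.point_zero]
  point_last := by rw [if_neg (by omega), Nat.add_sub_cancel_left, d.point_last]
  a_mem i hi := by
    split_ifs with h
    exacts [c.a_mem i h, d.a_mem _ (by omega)]
  b_mem i hi := by
    split_ifs with h
    exacts [c.b_mem i h, d.b_mem _ (by omega)]
  holo i hi := by
    split_ifs with h
    exacts [c.holo i h, d.holo _ (by omega)]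
  map_a i hi := by
    split_ifs with h
    exacts [c.map_a i h, d.map_a _ (by omega)]
  map_b i hi := by
    -- At the joint `i + 1 = c.k` the last disk of `c` ends at `c.point c.k`, while the new chain
    -- reads `d.point 0`; both are `q`.
    rcases lt_trichotomy (i + 1) c.k with h | h | h
    · simp only [if_pos h, if_pos (show i < c.k by omega), c.map_b i (by omega)]
    · simp only [if_pos (show i < c.k by omega), c.map_b i (by omega), h, lt_irrefl, if_false,
        Nat.sub_self, d.point_zero, c.point_last]
    · simp only [if_neg (show ¬ i < c.k by omega), if_neg (show ¬ i + 1 < c.k by omega),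
        d.map_b (i - c.k) (by omega)]
      congr 1
      omega

theorem HolomorphicChain.length_append {p q r : Y} (c : HolomorphicChain E p q)
    (d : HolomorphicChain E q r) : (c.append d).length = c.length + d.length := by
  simp only [HolomorphicChain.length, append_k, append_a, append_b, Finset.sum_range_add]
  congr 1
  · refine Finset.sum_congr rfl fun i hi => ?_
    rw [if_pos (Finset.mem_range.1 hi), if_pos (Finset.mem_range.1 hi)]
  · simp

theorem kobayashi_le_length {p q : Y} (c : HolomorphicChain E p q) :
    kobayashi E p q ≤ ENNReal.ofReal c.length :=
  iInf_le _ c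

theorem kobayashi_self (p : Y) : kobayashi E p p = 0 := by
  have h0 : (0 : ℂ) ∈ ball (0 : ℂ) 1 := mem_ball_self one_pos
  refine nonpos_iff_eq_zero.1 ((kobayashi_le_length
    (HolomorphicChain.single (fun _ => p) 0 0 h0 h0 mdifferentiableOn_const rfl rfl)).trans_eq ?_)
  simp [HolomorphicChain.length, poincareDist]

theorem kobayashi_comm (p q : Y) : kobayashi E p q = kobayashi E q p := by
  have h : ∀ p q : Y, kobayashi E p q ≤ kobayashi E q p := fun p q =>
    le_iInf fun c => c.length_reverse ▸ kobayashi_le_length c.reverse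
  exact le_antisymm (h p q) (h q p)

theorem kobayashi_triangle (p q r : Y) :
    kobayashi E p r ≤ kobayashi E p q + kobayashi E q r := by
  rw [kobayashi.eq_def E p q, ENNReal.iInf_add]
  refine le_iInf fun c => ?_
  rw [kobayashi.eq_def E q r, ENNReal.add_iInf]
  refine le_iInf fun d => (kobayashi_le_length (c.append d)).trans ?_
  rw [c.length_append]
  exact ENNReal.ofReal_add_le

/-- The Kobayashi pseudo-distance as an extended pseudo-metric. -/
noncomputable abbrev kobayashiPseudoEMetricSpace (E : Type*) [NormedAddCommGroup E] [NormedSpace ℂ E]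
    (Y : Type*) [TopologicalSpace Y] [ChartedSpace E Y] : PseudoEMetricSpace Y where
  edist := kobayashi E
  edist_self := kobayashi_self
  edist_comm := kobayashi_comm
  edist_triangle := kobayashi_triangle

/-- Both topologies have the same openness criterion, up to the symmetry of the distance. It lets
the Kobayashi uniformity be used with the given topology of `Y`. -/
theorem IsHyperbolic.toTopologicalSpace_eq (h : IsHyperbolic E Y) :
    (kobayashiPseudoEMetricSpace E Y).toUniformSpace.toTopologicalSpace =
      ‹TopologicalSpace Y› := by
  refine TopologicalSpace.ext_iff.2 fun U => ?_
  rw [h.isOpen_iff U, @EMetric.isOpen_iff Y (kobayashiPseudoEMetricSpace E Y)]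
  refine forall₂_congr fun p _ => exists_congr fun ε => and_congr_right fun _ =>
    forall_congr' fun q => ?_
  rw [kobayashi_comm p q]
  rfl

theorem IsCompleteHyperbolic.completeSpace (h : IsCompleteHyperbolic E Y) :
    @CompleteSpace Y (kobayashiPseudoEMetricSpace E Y).toUniformSpace := by
  refine @EMetric.complete_of_cauchySeq_tendsto Y (kobayashiPseudoEMetricSpace E Y) fun x hx => ?_
  rw [h.toTopologicalSpace_eq]
  exact h.complete x ((@EMetric.cauchySeq_iff Y ℕ (kobayashiPseudoEMetricSpace E Y) _ _ _).1 hx)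

theorem exists_artanh_lt {ε : ℝ≥0∞} (hε : 0 < ε) :
    ∃ s : ℝ, 0 < s ∧ s < 1 ∧ ENNReal.ofReal (Real.artanh s) < ε := by
  obtain ⟨δ, hδ, hδε⟩ := (ENNReal.lt_iff_exists_real_btwn.1 hε).imp fun _ h => h.2
  have hδ0 : 0 < δ := ENNReal.ofReal_pos.1 hδ
  refine ⟨Real.tanh δ, by rw [Real.tanh_eq_sinh_div_cosh]; exact div_pos (Real.sinh_pos_iff.2 hδ0) (Real.cosh_pos δ), Real.tanh_lt_one δ, ?_⟩
  rwa [Real.artanh_tanh]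

/-- Holomorphic maps are equicontinuous for the Kobayashi pseudo-distance of the target. -/
theorem equicontinuous_kobayashi {F : Type*} [NormedAddCommGroup F] [NormedSpace ℂ F]
    {A : Type*} [TopologicalSpace A] [ChartedSpace F A] [IsManifold 𝓘(ℂ, F) 1 A]
    {ι : Type*} {f : ι → A → Y} (hf : ∀ k, MDifferentiable 𝓘(ℂ, F) 𝓘(ℂ, E) (f k)) :
    @Equicontinuous ι A Y _ (kobayashiPseudoEMetricSpace E Y).toUniformSpace f := by
  let _ : PseudoEMetricSpace Y := kobayashiPseudoEMetricSpace E Y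
  intro z
  refine uniformity_basis_edist.equicontinuousAt_iff_right.2 fun ε hε => ?_
  obtain ⟨s, hs0, hs1, hsε⟩ := exists_artanh_lt hε
  obtain ⟨r, hr, hrs⟩ := exists_ball_subset_chart (F := F) z univ_mem
  -- For `φ x` within `r * s` of the center, the affine disk `l` with `l 0 = φ z` and `l s = φ x`
  -- stays in the ball of radius `r`. Its image under `f k` is a one-disk chain of length `artanh
  -- s`, whatever `k` is.
  filter_upwards [chartBall_mem_nhds (F := F) z (mul_pos hr hs0)] with x hx k
  set φ := chartAt F z
  let l : ℂ → F := fun t => φ z + (t / s) • (φ x - φ z)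
  have hs : (s : ℂ) ≠ 0 := by exact_mod_cast hs0.ne'
  have hl : MapsTo l (ball 0 1) (ball (φ z) r) := by
    intro t ht
    have hx2 : ‖φ x - φ z‖ < r * s := by
      rw [← dist_eq_norm]
      exact hx.2
    rw [mem_ball_zero_iff] at ht
    rw [mem_ball, dist_eq_norm]
    simp only [l, add_sub_cancel_left, norm_smul, norm_div, Complex.norm_real, Real.norm_eq_abs,
      abs_of_pos hs0]
    calc ‖t‖ / s * ‖φ x - φ z‖ ≤ 1 / s * ‖φ x - φ z‖ := by gcongr
      _ < 1 / s * (r * s) := by gcongr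
      _ = r := by field_simp
  have hlhol : MDifferentiableOn 𝓘(ℂ, ℂ) 𝓘(ℂ, F) l (ball 0 1) :=
    (show Differentiable ℂ l by fun_prop).differentiableOn.mdifferentiableOn
  refine (kobayashi_le_length (HolomorphicChain.single ((f k ∘ φ.symm) ∘ l) 0 s
    (mem_ball_self one_pos) ?_ ?_ ?_ ?_)).trans_lt ?_
  · simpa [abs_of_pos hs0] using hs1
  · exact (mdifferentiableOn_comp_chart_symm (hf k).mdifferentiableOn z hrs).comp hlhol hl
  · simp [l, φ, φ.left_inv (mem_chart_source F z)]
  · simp [l, hs, φ.left_inv hx.1]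
  · simpa [HolomorphicChain.length, poincareDist, abs_of_pos hs0] using hsε

end Kobayashi

end Vitali

theorem corollary3p13 :
    (∀ (E : Type u) [NormedAddCommGroup E] [NormedSpace ℂ E] [CompleteSpace E]
        (Y : Type v) [TopologicalSpace Y] [ChartedSpace E Y] [IsManifold 𝓘(ℂ, E) ω Y]
        [ConnectedSpace Y], Vitali.IsCompleteHyperbolic E Y →
        ∀ X : TopologicalSpace.Opens Y,
          Vitali.WVP.{u, v, w, t} E X ↔ Vitali.SVP.{u, v, w, t} E X) ∧
    (∀ (E : Type u) [NormedAddCommGroup E] [NormedSpace ℂ E] [CompleteSpace E]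
        (X : TopologicalSpace.Opens E), Bornology.IsBounded (X : Set E) →
        (Vitali.WVP.{u, u, w, t} E X ↔ Vitali.SVP.{u, u, w, t} E X)) := by
  refine ⟨fun E _ _ _ Y _ _ _ _ hY X => ⟨fun h => ?_, fun h => h.wvp⟩,
    fun E _ _ _ X hX => ⟨fun h => ?_, fun h => h.wvp⟩⟩
  · refine h.svp X (Vitali.kobayashiPseudoEMetricSpace E Y).toUniformSpace
      hY.toTopologicalSpace_eq hY.completeSpace fun F _ _ A _ _ _ f hf _ => ?_
    have : IsManifold 𝓘(ℂ, F) 1 A := IsManifold.of_le (n := ω) le_top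
    exact Vitali.equicontinuous_kobayashi hf
  -- Here the norm uniformity of the complete space `E` replaces the Kobayashi one, so no hyperbolic
  -- manifold around `X` is needed.
  · obtain ⟨M, hM⟩ := hX.exists_norm_le
    refine h.svp X _ rfl inferInstance fun F _ _ A _ _ _ f hf hfX => ?_
    have : IsManifold 𝓘(ℂ, F) 1 A := IsManifold.of_le (n := ω) le_top
    exact Vitali.equicontinuous_of_bounded hf fun k x => hM _ (hfX k x)
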